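/- Let $N\ge 1$ be an integer and let $s\in(0,1)$. Consider the equation $$\Delta u-(-\Delta)^s u-\rho\,c\,u=0\quad\text{in }\mathbb R^N,\qquad (1)$$ where $$(-\Delta)^s u(x)=C_{N,s}\lim_{\varepsilon\to0^+}\int_{\{|x-y|\ge\varepsilon\}}\frac{u(x)-u(y)}{|x-y|^{N+2s}}\,dy,\qquad C_{N,s}=\frac{2^{2s-1}\,2s\,\Gamma\big(\frac{N+2s}{2}\big)}{\pi^{N/2}\,\Gamma(1-s)} .$$ A classical solution of (1) is a function $u\in C^2(\mathbb R^N)$ with $\int_{\mathbb R^N}\frac{|u(x)|}{1+|x|^{N+2s}}\,dx<\infty$ such that, at every $x\in\mathbb R^N$, the limit defining $(-\Delta)^s u(x)$ exists and is finite, and (1) holds. For all $\alpha$ and $C_0$ with $0\le\alpha<2s$ and $C_0>0$ there is a constant $K$, depending only on $N,s,\alpha,C_0$, such that the following holds. Let $p\ge1$ and $c_0>0$ be real numbers with $p\,c_0\ge K$. Let $\rho,c:\mathbb R^N\to\mathbb R$ be continuous with $$\rho(x)\ge C_0(1+|x|^2)^{-\alpha/2},\qquad c(x)\ge c_0\qquad\text{for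 all }x\in\mathbb R^N .$$ If $u$ is a classical solution of (1) and, for some $C>0$ and some $\theta$ with $0\le\theta<2s-\alpha$, $$|u(x)|\le C(1+|x|^2)^{\theta/2}\qquad\text{for all }x\in\mathbb R^N,$$ then $u(x)=0$ for all $x\in\mathbb R^N$. -/

import Mathlib

open Set Filter Topology MeasureTheory

noncomputable section

namespace MixedElliptic

/-- Euclidean space of dimension `N`, with the Euclidean norm and Lebesgue measure. -/
abbrev Eucl (N : ℕ) : Type := EuclideanSpace ℝ (Fin N)

/-- The normalization constant `C_{N,s}` of the fractional Laplacian. -/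
def fracConst (N : ℕ) (s : ℝ) : ℝ :=
  2 ^ (2 * s - 1) * (2 * s) * Real.Gamma (((N : ℝ) + 2 * s) / 2) /
    (Real.pi ^ ((N : ℝ) / 2) * Real.Gamma (1 - s))

/-- The truncated singular integral
`C_{N,s} ∫_{|x-y| ≥ ε} (u(x) - u(y)) / |x-y|^{N+2s} dy`. -/
def truncFracLaplacian {N : ℕ} (s : ℝ) (u : Eucl N → ℝ) (x : Eucl N) (ε : ℝ) : ℝ :=
  fracConst N s *
    ∫ y in {y : Eucl N | ε ≤ ‖x - y‖}, (u x - u y) / ‖x - y‖ ^ ((N : ℝ) + 2 * s)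

/-- `(-Δ)^s u (x)` exists (as a principal value, finite) and equals `l`. -/
def HasFracLaplacianAt {N : ℕ} (s : ℝ) (u : Eucl N → ℝ) (l : ℝ) (x : Eucl N) : Prop :=
  Tendsto (fun ε : ℝ => truncFracLaplacian s u x ε) (𝓝[>] 0) (𝓝 l)

/-- The space of (measurable) functions `f` with `∫ |f(x)| / (1 + |x|^{N+2s}) dx < ∞`. -/
def MemLs {N : ℕ} (s : ℝ) (f : Eucl N → ℝ) : Prop :=
  Integrable (fun x : Eucl N => f x / (1 + ‖x‖ ^ ((N : ℝ) + 2 * s)))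

/-- Hypothesis on `ρ`: it is continuous and `ρ(x) ≥ C₀ (1 + |x|²)^{-α/2}`,
with `α ≥ 0` and `C₀ > 0`. -/
structure HypRho {N : ℕ} (α C₀ : ℝ) (ρ : Eucl N → ℝ) : Prop where
  continuous : Continuous ρ
  alpha_nonneg : 0 ≤ α
  const_pos : 0 < C₀
  lower_bound : ∀ x, C₀ * (1 + ‖x‖ ^ 2) ^ (-α / 2) ≤ ρ x

/-- Hypothesis on `c`: it is continuous and nonnegative. -/
structure HypC {N : ℕ} (c : Eucl N → ℝ) : Prop where
  continuous : Continuous c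
  nonneg : ∀ x, 0 ≤ c x

/-- Classical solution of `Δu - (-Δ)^s u - ρ c u = 0` in the whole space. -/
structure IsClassicalSolution {N : ℕ} (s : ℝ) (ρ c u : Eucl N → ℝ) : Prop where
  contDiff : ContDiff ℝ 2 u
  memLs : MemLs s u
  equation : ∀ x, ∃ l : ℝ, HasFracLaplacianAt s u l x ∧
    Laplacian.laplacian u x - l - ρ x * c x * u x = 0

end MixedElliptic

end

/-!
The barrier is a power `⟨x⟩ ^ β` of the Japanese bracket `⟨x⟩ = (1 + ‖x‖²) ^ (1 / 2)`, with
`θ < β < 2 s - α`. Since `u` grows more slowly than the barrier, `u - ε ⟨·⟩ ^ β` attains a global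
maximum at some `x₀`, where the second differences of `u` are at most `ε` times those of the
barrier. Concavity of `t ↦ t ^ (β / 2)` and the parallelogram law bound the latter by
`2 ⟨x₀⟩ ^ β (⟨z / ⟨x₀⟩⟩ ^ β - 1)`. This one estimate controls both `Δ u` and, after symmetrization
and scaling of the singular integral, `-(-Δ)^s u`, and gives
`Δ u (x₀) - (-Δ)^s u (x₀) ≤ K ε ⟨x₀⟩ ^ (-α)`. The potential is at least `κ ⟨x₀⟩ ^ (-α)`, so
`u x₀ ≤ ε K / κ`; letting `ε → 0` gives `u ≤ 0`, and the same applies to `-u`.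
-/

namespace MixedElliptic

section BracketPow

variable {E : Type*} [NormedAddCommGroup E]

/-- The power `⟨x⟩ ^ β` of the Japanese bracket `⟨x⟩ = (1 + ‖x‖²) ^ (1 / 2)`. It is both the weight
in which growth is measured and the barrier of the maximum principle. -/
noncomputable def bracketPow (β : ℝ) (x : E) : ℝ :=
  (1 + ‖x‖ ^ 2) ^ (β / 2)

theorem bracketPow_pos (β : ℝ) (x : E) : 0 < bracketPow β x :=
  Real.rpow_pos_of_pos (by positivity) _

theorem bracketPow_le_bracketPow {β γ : ℝ} (h : β ≤ γ) (x : E) :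
    bracketPow β x ≤ bracketPow γ x :=
  Real.rpow_le_rpow_of_exponent_le (by linarith [sq_nonneg ‖x‖]) (by linarith)

theorem one_le_bracketPow {β : ℝ} (hβ : 0 ≤ β) (x : E) : 1 ≤ bracketPow β x :=
  Real.one_le_rpow (by linarith [sq_nonneg ‖x‖]) (by linarith)

theorem bracketPow_add (β γ : ℝ) (x : E) :
    bracketPow (β + γ) x = bracketPow β x * bracketPow γ x := by
  rw [bracketPow, add_div, Real.rpow_add (by positivity), bracketPow, bracketPow]

theorem bracketPow_one_rpow (β : ℝ) (x : E) : bracketPow 1 x ^ β = bracketPow β x := by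
  rw [bracketPow, bracketPow, ← Real.rpow_mul (by positivity), one_div_mul_eq_div]

theorem bracketPow_two (x : E) : bracketPow 2 x = 1 + ‖x‖ ^ 2 := by
  rw [bracketPow, div_self two_ne_zero, Real.rpow_one]

theorem continuous_bracketPow (β : ℝ) : Continuous (bracketPow β : E → ℝ) := by
  refine Continuous.rpow_const (by fun_prop) fun x => Or.inl ?_
  positivity

theorem tendsto_bracketPow_cocompact [ProperSpace E] {β : ℝ} (hβ : 0 < β) :
    Tendsto (bracketPow β : E → ℝ) (cocompact E) atTop :=
  (tendsto_rpow_atTop (half_pos hβ)).comp <| tendsto_atTop_add_const_left _ _ <|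
    (tendsto_pow_atTop two_ne_zero).comp tendsto_norm_cocompact_atTop

theorem tendsto_const_mul_bracketPow_sub_cocompact [ProperSpace E] {θ β ε : ℝ} (hθ : 0 ≤ θ)
    (hθβ : θ < β) (hε : 0 < ε) (C : ℝ) :
    Tendsto (fun x : E => ε * bracketPow β x - C * bracketPow θ x) (cocompact E) atTop := by
  have hlim : Tendsto (fun x : E => ε * bracketPow (β - θ) x - C) (cocompact E) atTop :=
    tendsto_atTop_add_const_right _ _
      ((tendsto_bracketPow_cocompact (sub_pos.2 hθβ)).const_mul_atTop hε)
  refine tendsto_atTop_mono' _ ?_ hlim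
  filter_upwards [hlim.eventually_ge_atTop 0] with x hx
  calc ε * bracketPow (β - θ) x - C
      ≤ (ε * bracketPow (β - θ) x - C) * bracketPow θ x :=
        le_mul_of_one_le_right hx (one_le_bracketPow hθ x)
    _ = ε * bracketPow β x - C * bracketPow θ x := by
        rw [sub_mul, mul_assoc, ← bracketPow_add, sub_add_cancel]

theorem bracketPow_sub_one_le_mul_norm_sq {β : ℝ} (h0 : 0 ≤ β) (h2 : β ≤ 2) (z : E) :
    bracketPow β z - 1 ≤ β / 2 * ‖z‖ ^ 2 := by
  have h := rpow_one_add_le_one_add_mul_self (s := ‖z‖ ^ 2) (p := β / 2)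
    (by linarith [sq_nonneg ‖z‖]) (by linarith) (by linarith)
  rw [bracketPow]
  linarith

theorem bracketPow_sub_one_le_norm_rpow {β : ℝ} (h0 : 0 ≤ β) (h2 : β ≤ 2) (z : E) :
    bracketPow β z - 1 ≤ ‖z‖ ^ β := by
  have h := Real.rpow_add_le_add_rpow zero_le_one (sq_nonneg ‖z‖) (p := β / 2)
    (by linarith) (by linarith)
  have hpow : (‖z‖ ^ 2) ^ (β / 2) = ‖z‖ ^ β := by
    rw [← Real.rpow_natCast, ← Real.rpow_mul (norm_nonneg z)]
    congr 1
    push_cast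
    ring
  rw [Real.one_rpow, hpow] at h
  rw [bracketPow]
  linarith

end BracketPow

section SecondDiff

variable {E : Type*} [NormedAddCommGroup E]

/-- The symmetric second difference of `u` at `x`. It controls both the Laplacian (through pure
second derivatives) and the fractional Laplacian (through symmetrization of the integral). -/
def secondDiff (u : E → ℝ) (x z : E) : ℝ :=
  u (x + z) + u (x - z) - 2 * u x

theorem secondDiff_le_of_isMaxOn {u v : E → ℝ} {ε : ℝ} {x : E}
    (hmax : IsMaxOn (fun y => u y - ε * v y) univ x) (z : E) :
    secondDiff u x z ≤ ε * secondDiff v x z := by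
  have hadd : u (x + z) - ε * v (x + z) ≤ u x - ε * v x := hmax (mem_univ _)
  have hsub : u (x - z) - ε * v (x - z) ≤ u x - ε * v x := hmax (mem_univ _)
  unfold secondDiff
  linarith

variable [InnerProductSpace ℝ E]

theorem secondDiff_bracketPow_le {β : ℝ} (h0 : 0 ≤ β) (h2 : β ≤ 2) (x z : E) :
    secondDiff (bracketPow β) x z ≤
      2 * bracketPow β x * (bracketPow β ((bracketPow 1 x)⁻¹ • z) - 1) := by
  have hx : 0 < bracketPow 2 x := bracketPow_pos 2 x
  have hnorm : ‖(bracketPow 1 x)⁻¹ • z‖ ^ 2 = ‖z‖ ^ 2 / bracketPow 2 x := by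
    rw [norm_smul, norm_inv, Real.norm_of_nonneg (bracketPow_pos 1 x).le, mul_pow, inv_pow,
      ← Real.rpow_two, bracketPow_one_rpow, inv_mul_eq_div]
  have hscale : bracketPow β x * bracketPow β ((bracketPow 1 x)⁻¹ • z) =
      (1 + ‖x‖ ^ 2 + ‖z‖ ^ 2) ^ (β / 2) := by
    rw [bracketPow, bracketPow, hnorm, ← Real.mul_rpow (by positivity) (by positivity),
      ← bracketPow_two x]
    field_simp
  -- By the parallelogram law, `⟨x + z⟩²` and `⟨x - z⟩²` have midpoint `⟨x⟩² + ‖z‖²`.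
  have hmid : 1 / 2 * (1 + ‖x + z‖ ^ 2) + 1 / 2 * (1 + ‖x - z‖ ^ 2) = 1 + ‖x‖ ^ 2 + ‖z‖ ^ 2 := by
    linarith [parallelogram_law_with_norm ℝ x z]
  have hconc := (Real.concaveOn_rpow (by linarith : 0 ≤ β / 2) (by linarith)).right
    (mem_Ici.2 (by positivity : 0 ≤ 1 + ‖x + z‖ ^ 2))
    (mem_Ici.2 (by positivity : 0 ≤ 1 + ‖x - z‖ ^ 2))
    one_half_pos.le one_half_pos.le (add_halves 1)
  simp only [smul_eq_mul, hmid] at hconc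
  rw [← hscale] at hconc
  have : secondDiff (bracketPow β) x z =
      (1 + ‖x + z‖ ^ 2) ^ (β / 2) + (1 + ‖x - z‖ ^ 2) ^ (β / 2) - 2 * bracketPow β x := rfl
  linarith

theorem secondDiff_bracketPow_le_mul_norm_sq {β : ℝ} (h0 : 0 ≤ β) (h2 : β ≤ 2) (x z : E) :
    secondDiff (bracketPow β) x z ≤ β * bracketPow (β - 2) x * ‖z‖ ^ 2 := by
  have hr := bracketPow_pos 1 x
  calc secondDiff (bracketPow β) x z
      ≤ 2 * bracketPow β x * (bracketPow β ((bracketPow 1 x)⁻¹ • z) - 1) :=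
        secondDiff_bracketPow_le h0 h2 x z
    _ ≤ 2 * bracketPow β x * (β / 2 * ‖(bracketPow 1 x)⁻¹ • z‖ ^ 2) :=
        mul_le_mul_of_nonneg_left (bracketPow_sub_one_le_mul_norm_sq h0 h2 _)
          (by have := bracketPow_pos β x; positivity)
    _ = β * bracketPow (β - 2) x * ‖z‖ ^ 2 := by
        rw [norm_smul, norm_inv, Real.norm_of_nonneg hr.le, ← bracketPow_one_rpow (β - 2),
          Real.rpow_sub hr, Real.rpow_two, bracketPow_one_rpow]
        field_simp

end SecondDiff

section Laplacian

theorem deriv_deriv_nonpos_of_isLocalMax {h : ℝ → ℝ} {t : ℝ} (hmax : IsLocalMax h t)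
    (hc : ContinuousAt h t) : deriv (deriv h) t ≤ 0 := by
  by_contra! hpos
  have hmin := isLocalMin_of_deriv_deriv_pos hpos hmax.deriv_eq_zero hc
  have hconst : h =ᶠ[𝓝 t] fun _ => h t := by
    filter_upwards [hmax, hmin] with y hle hge using le_antisymm hle hge
  have hzero := hconst.deriv.deriv_eq
  simp only [deriv_const'] at hzero
  exact hpos.ne' hzero

theorem deriv_deriv_le_of_secondDiff_le {h : ℝ → ℝ} (hh : ContDiff ℝ 2 h) {t₀ b : ℝ}
    (hb : ∀ t, secondDiff h t₀ t ≤ b * t ^ 2) : deriv (deriv h) t₀ ≤ b := by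
  have hh1 : Differentiable ℝ h := hh.differentiable two_ne_zero
  have hh2 : Differentiable ℝ (deriv h) := hh.differentiable_deriv_two
  have hsq (t : ℝ) : HasDerivAt (fun t => b * t ^ 2) (2 * b * t) t :=
    ((hasDerivAt_pow 2 t).const_mul b).congr_deriv (by push_cast; ring)
  have hφ (t : ℝ) : HasDerivAt (fun t => secondDiff h t₀ t - b * t ^ 2)
      (deriv h (t₀ + t) - deriv h (t₀ - t) - 2 * b * t) t :=
    (((((hh1 _).hasDerivAt.comp_const_add t₀ t).add
      ((hh1 _).hasDerivAt.comp_const_sub t₀ t)).sub_const _).sub (hsq t)).congr_deriv (by ring)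
  have hφ' : HasDerivAt (fun t => deriv h (t₀ + t) - deriv h (t₀ - t) - 2 * b * t)
      (2 * (deriv (deriv h) t₀ - b)) 0 := by
    refine ((((hh2 _).hasDerivAt.comp_const_add t₀ 0).sub
      ((hh2 _).hasDerivAt.comp_const_sub t₀ 0)).sub
      ((hasDerivAt_id (0 : ℝ)).const_mul (2 * b))).congr_deriv ?_
    rw [add_zero, sub_zero]
    ring
  have hmax : IsLocalMax (fun t => secondDiff h t₀ t - b * t ^ 2) 0 := by
    refine Eventually.of_forall fun t => ?_
    have hzero : secondDiff h t₀ 0 = 0 := by simp [secondDiff, two_mul]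
    simpa [hzero] using hb t
  have hle := deriv_deriv_nonpos_of_isLocalMax hmax (hφ 0).continuousAt
  rw [funext fun t => (hφ t).deriv, hφ'.deriv] at hle
  linarith

theorem iteratedFDeriv_two_eq_deriv_deriv {E : Type*} [NormedAddCommGroup E] [NormedSpace ℝ E]
    {u : E → ℝ} (hu : ContDiff ℝ 2 u) (x e : E) :
    iteratedFDeriv ℝ 2 u x ![e, e] = deriv (deriv fun t : ℝ => u (x + t • e)) 0 := by
  have hline (t : ℝ) : HasDerivAt (fun t : ℝ => x + t • e) e t := by
    simpa using ((hasDerivAt_id t).smul_const e).const_add x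
  have hd1 (t : ℝ) : HasDerivAt (fun t : ℝ => u (x + t • e)) (fderiv ℝ u (x + t • e) e) t :=
    (hu.differentiable two_ne_zero _).hasFDerivAt.comp_hasDerivAt t (hline t)
  have hu2 : Differentiable ℝ (fderiv ℝ u) :=
    (hu.fderiv_right (m := 1) (by norm_num)).differentiable one_ne_zero
  have hd2 : HasDerivAt (fun t : ℝ => fderiv ℝ u (x + t • e) e)
      (fderiv ℝ (fderiv ℝ u) x e e) 0 := by
    simpa using ((hu2 _).hasFDerivAt.comp_hasDerivAt (0 : ℝ) (hline 0)).clm_apply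
      (hasDerivAt_const (0 : ℝ) e)
  rw [funext fun t => (hd1 t).deriv, hd2.deriv, iteratedFDeriv_two_apply]
  simp

theorem laplacian_le_of_secondDiff_le {E : Type*} [NormedAddCommGroup E] [InnerProductSpace ℝ E]
    [FiniteDimensional ℝ E] {u : E → ℝ} (hu : ContDiff ℝ 2 u) {x : E} {b : ℝ}
    (hb : ∀ z, secondDiff u x z ≤ b * ‖z‖ ^ 2) :
    Laplacian.laplacian u x ≤ Module.finrank ℝ E * b := by
  rw [congrFun (InnerProductSpace.laplacian_eq_iteratedFDeriv_stdOrthonormalBasis u) x]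
  refine (Finset.sum_le_card_nsmul _ _ b fun i _ => ?_).trans_eq (by simp)
  set e := stdOrthonormalBasis ℝ E i
  rw [iteratedFDeriv_two_eq_deriv_deriv hu]
  refine deriv_deriv_le_of_secondDiff_le (by fun_prop) fun t => ?_
  have he : ‖e‖ = 1 := (stdOrthonormalBasis ℝ E).norm_eq_one i
  simpa [secondDiff, sub_eq_add_neg, norm_smul, he] using hb (t • e)

end Laplacian

section BracketKernel

variable {E : Type*} [NormedAddCommGroup E]

/-- The kernel whose integral is, up to sign and normalization, the fractional Laplacian of
`⟨·⟩ ^ β` at the origin; here `ν` plays the role of `N + 2 s`. -/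
noncomputable def bracketKernel (ν β : ℝ) (z : E) : ℝ :=
  (bracketPow β z - 1) / ‖z‖ ^ ν

theorem bracketKernel_nonneg (ν : ℝ) {β : ℝ} (hβ : 0 ≤ β) (z : E) : 0 ≤ bracketKernel ν β z :=
  div_nonneg (sub_nonneg.2 (one_le_bracketPow hβ z)) (by positivity)

variable [NormedSpace ℝ E]

theorem bracketKernel_inv_smul {r : ℝ} (hr : 0 < r) (ν β : ℝ) (z : E) :
    bracketKernel ν β (r⁻¹ • z) = r ^ ν * ((bracketPow β (r⁻¹ • z) - 1) / ‖z‖ ^ ν) := by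
  rw [bracketKernel, norm_smul, norm_inv, Real.norm_of_nonneg hr.le,
    Real.mul_rpow (inv_nonneg.2 hr.le) (norm_nonneg z), Real.inv_rpow hr.le]
  field_simp

variable [FiniteDimensional ℝ E] [MeasurableSpace E] [BorelSpace E]

theorem integrableOn_norm_rpow_neg (μ : Measure E) [μ.IsAddHaarMeasure] {r δ : ℝ}
    (hr : Module.finrank ℝ E < r) (hδ : 0 < δ) :
    IntegrableOn (fun z : E => ‖z‖ ^ (-r)) {z | δ ≤ ‖z‖} μ := by
  have hr0 : 0 ≤ r := (Nat.cast_nonneg _).trans hr.le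
  refine (((integrable_one_add_norm (μ := μ) hr).const_mul ((δ⁻¹ + 1) ^ r)).integrableOn).mono'
    (by fun_prop : Measurable _).aestronglyMeasurable ?_
  refine ae_restrict_of_forall_mem (measurableSet_le (by fun_prop) (by fun_prop))
    fun z (hz : δ ≤ ‖z‖) => ?_
  have hz0 : 0 < ‖z‖ := hδ.trans_le hz
  have hcmp : 1 + ‖z‖ ≤ (δ⁻¹ + 1) * ‖z‖ := by
    have : 1 ≤ δ⁻¹ * ‖z‖ := by rwa [inv_mul_eq_div, one_le_div hδ]
    linarith
  rw [Real.norm_of_nonneg (by positivity), Real.rpow_neg hz0.le, Real.rpow_neg (by positivity),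
    ← div_eq_mul_inv, ← one_div, div_le_div_iff₀ (by positivity) (by positivity), one_mul,
    ← Real.mul_rpow (by positivity) hz0.le]
  gcongr

theorem integrable_bracketKernel (μ : Measure E) [μ.IsAddHaarMeasure] {ν β : ℝ} (hβ : 0 ≤ β)
    (hνβ : Module.finrank ℝ E + β < ν) (hν : ν < Module.finrank ℝ E + 2) :
    Integrable (bracketKernel (E := E) ν β) μ := by
  rcases subsingleton_or_nontrivial E with hE | hE
  · have hzero : bracketKernel (E := E) ν β = 0 := by
      ext z
      simp [bracketKernel, bracketPow, Subsingleton.elim z 0]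
    exact hzero ▸ integrable_zero E ℝ μ
  have hβ2 : β ≤ 2 := by linarith
  have hmeas : AEStronglyMeasurable (bracketKernel (E := E) ν β) μ :=
    (((continuous_bracketPow β).measurable.sub_const 1).div (by fun_prop)).aestronglyMeasurable
  have hpow {z : E} (p : ℝ) (hz : 0 < ‖z‖) : ‖z‖ ^ p / ‖z‖ ^ ν = ‖z‖ ^ (-(ν - p)) := by
    rw [neg_sub, Real.rpow_sub hz]
  have hnear : IntegrableOn (bracketKernel ν β) (Metric.ball (0 : E) 1) μ := by
    refine integrableOn_ball_of_norm_le_rpow (C := β / 2) (α := ν - 2)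
      Module.finrank_pos (by linarith) (ae_restrict_of_ae (ae_of_all _ fun z => ?_)) hmeas
    rw [Real.norm_of_nonneg (bracketKernel_nonneg ν hβ z)]
    rcases (norm_nonneg z).eq_or_lt with hz | hz
    · have : z = 0 := norm_eq_zero.1 hz.symm
      simpa [bracketKernel, bracketPow, this] using by positivity
    · rw [← hpow 2 hz, Real.rpow_two, ← mul_div_assoc, bracketKernel]
      gcongr
      exact bracketPow_sub_one_le_mul_norm_sq hβ hβ2 z
  have hfar : IntegrableOn (bracketKernel ν β) {z : E | 1 ≤ ‖z‖} μ := by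
    refine (integrableOn_norm_rpow_neg μ (by linarith : _ < ν - β) one_pos).mono' hmeas.restrict ?_
    refine ae_restrict_of_forall_mem (measurableSet_le (by fun_prop) (by fun_prop))
      fun z (hz : 1 ≤ ‖z‖) => ?_
    rw [Real.norm_of_nonneg (bracketKernel_nonneg ν hβ z), ← hpow β (one_pos.trans_le hz),
      bracketKernel]
    gcongr
    exact bracketPow_sub_one_le_norm_rpow hβ hβ2 z
  rw [← integrableOn_univ]
  refine (hnear.union hfar).mono_set fun z _ => ?_
  simpa [Metric.mem_ball] using lt_or_ge ‖z‖ 1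

end BracketKernel

section FractionalLaplacian

variable {N : ℕ} {s : ℝ}

theorem fracConst_nonneg (N : ℕ) (hs0 : 0 < s) (hs1 : s < 1) : 0 ≤ fracConst N s := by
  have hnum := Real.Gamma_nonneg_of_nonneg (by positivity : 0 ≤ ((N : ℝ) + 2 * s) / 2)
  have hden := Real.Gamma_nonneg_of_nonneg (by linarith : 0 ≤ 1 - s)
  exact div_nonneg (mul_nonneg (by positivity) hnum) (mul_nonneg (by positivity) hden)

theorem one_add_norm_add_rpow_le {E : Type*} [SeminormedAddCommGroup E] {ν δ : ℝ} (hν : 0 ≤ ν)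
    (hδ : 0 < δ) (x : E) {z : E} (hz : δ ≤ ‖z‖) :
    1 + ‖x + z‖ ^ ν ≤ ((δ⁻¹) ^ ν + (‖x‖ * δ⁻¹ + 1) ^ ν) * ‖z‖ ^ ν := by
  have hone : 1 ≤ δ⁻¹ * ‖z‖ := by rwa [inv_mul_eq_div, one_le_div hδ]
  have hadd : ‖x + z‖ ≤ (‖x‖ * δ⁻¹ + 1) * ‖z‖ := by
    have := mul_le_mul_of_nonneg_left hone (norm_nonneg x)
    linarith [norm_add_le x z]
  rw [add_mul, ← Real.mul_rpow (by positivity) (by positivity),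
    ← Real.mul_rpow (by positivity) (by positivity)]
  gcongr
  exact Real.one_le_rpow hone hν

theorem MemLs.integrableOn_comp_add_div {u : Eucl N → ℝ} (hu : MemLs s u) (hs : 0 ≤ s) {δ : ℝ}
    (hδ : 0 < δ) (x : Eucl N) :
    IntegrableOn (fun z => u (x + z) / ‖z‖ ^ ((N : ℝ) + 2 * s)) {z | δ ≤ ‖z‖} := by
  set ν : ℝ := N + 2 * s
  have hν : 0 ≤ ν := by positivity
  have hS : MeasurableSet {z : Eucl N | δ ≤ ‖z‖} := measurableSet_le (by fun_prop) (by fun_prop)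
  have hprod := (hu.comp_add_left x).integrableOn.mul_bdd
    (μ := volume.restrict {z : Eucl N | δ ≤ ‖z‖})
    (g := fun z : Eucl N => (1 + ‖x + z‖ ^ ν) / ‖z‖ ^ ν)
    (c := (δ⁻¹) ^ ν + (‖x‖ * δ⁻¹ + 1) ^ ν)
    (by fun_prop : Measurable _).aestronglyMeasurable
    (ae_restrict_of_forall_mem hS fun z (hz : δ ≤ ‖z‖) => by
      have hz0 : 0 < ‖z‖ := hδ.trans_le hz
      rw [Real.norm_of_nonneg (by positivity), div_le_iff₀ (by positivity)]
      exact one_add_norm_add_rpow_le hν hδ x hz)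
  refine hprod.congr (ae_of_all _ fun z => ?_)
  exact div_mul_div_cancel₀ (by positivity)

theorem MemLs.integrableOn_sub_div {u : Eucl N → ℝ} (hu : MemLs s u) (hs : 0 < s) {δ : ℝ}
    (hδ : 0 < δ) (x : Eucl N) :
    IntegrableOn (fun z => (u (x + z) - u x) / ‖z‖ ^ ((N : ℝ) + 2 * s)) {z | δ ≤ ‖z‖} := by
  have hconst := (integrableOn_norm_rpow_neg (volume : Measure (Eucl N))
    (by rw [finrank_euclideanSpace_fin]; linarith : _ < (N : ℝ) + 2 * s) hδ).const_mul (u x)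
  refine ((hu.integrableOn_comp_add_div hs.le hδ x).sub hconst).congr (ae_of_all _ fun z => ?_)
  simp only [Pi.sub_apply]
  rw [sub_div, Real.rpow_neg (norm_nonneg z), div_eq_mul_inv (u x)]

theorem measurePreserving_neg_restrict_le_norm {E : Type*} [NormedAddCommGroup E]
    [MeasurableSpace E] [BorelSpace E] (μ : Measure E) [μ.IsNegInvariant] (δ : ℝ) :
    MeasurePreserving (fun z : E => -z) (μ.restrict {z | δ ≤ ‖z‖}) (μ.restrict {z | δ ≤ ‖z‖}) := by
  simpa using (Measure.measurePreserving_neg μ).restrict_preimage_emb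
    (MeasurableEquiv.neg E).measurableEmbedding {z | δ ≤ ‖z‖}

theorem secondDiff_div_norm_rpow {E : Type*} [NormedAddCommGroup E] (u : E → ℝ) (ν : ℝ) (x z : E) :
    secondDiff u x z / ‖z‖ ^ ν =
      (u (x + z) - u x) / ‖z‖ ^ ν + (u (x + -z) - u x) / ‖-z‖ ^ ν := by
  rw [secondDiff, norm_neg, ← sub_eq_add_neg]
  ring

theorem MemLs.integrableOn_sub_div_neg {u : Eucl N → ℝ} (hu : MemLs s u) (hs : 0 < s) {δ : ℝ}
    (hδ : 0 < δ) (x : Eucl N) :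
    IntegrableOn (fun z => (u (x + -z) - u x) / ‖-z‖ ^ ((N : ℝ) + 2 * s)) {z | δ ≤ ‖z‖} :=
  ((measurePreserving_neg_restrict_le_norm volume δ).integrable_comp_emb
    (MeasurableEquiv.neg _).measurableEmbedding).2 (hu.integrableOn_sub_div hs hδ x)

theorem MemLs.integrableOn_secondDiff_div {u : Eucl N → ℝ} (hu : MemLs s u) (hs : 0 < s) {δ : ℝ}
    (hδ : 0 < δ) (x : Eucl N) :
    IntegrableOn (fun z => secondDiff u x z / ‖z‖ ^ ((N : ℝ) + 2 * s)) {z | δ ≤ ‖z‖} := by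
  simp only [secondDiff_div_norm_rpow]
  exact (hu.integrableOn_sub_div hs hδ x).add (hu.integrableOn_sub_div_neg hs hδ x)

theorem MemLs.setIntegral_secondDiff_div {u : Eucl N → ℝ} (hu : MemLs s u) (hs : 0 < s) {δ : ℝ}
    (hδ : 0 < δ) (x : Eucl N) :
    ∫ z in {z : Eucl N | δ ≤ ‖z‖}, secondDiff u x z / ‖z‖ ^ ((N : ℝ) + 2 * s) =
      2 * ∫ z in {z : Eucl N | δ ≤ ‖z‖}, (u (x + z) - u x) / ‖z‖ ^ ((N : ℝ) + 2 * s) := by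
  simp only [secondDiff_div_norm_rpow]
  rw [integral_add (hu.integrableOn_sub_div hs hδ x) (hu.integrableOn_sub_div_neg hs hδ x),
    (measurePreserving_neg_restrict_le_norm volume δ).integral_comp
      (MeasurableEquiv.neg _).measurableEmbedding
      fun z => (u (x + z) - u x) / ‖z‖ ^ ((N : ℝ) + 2 * s), ← two_mul]

theorem truncFracLaplacian_eq_setIntegral (s : ℝ) (u : Eucl N → ℝ) (x : Eucl N) (δ : ℝ) :
    truncFracLaplacian s u x δ = -fracConst N s *
      ∫ z in {z : Eucl N | δ ≤ ‖z‖}, (u (x + z) - u x) / ‖z‖ ^ ((N : ℝ) + 2 * s) := by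
  have hpre : (x + ·) ⁻¹' {y : Eucl N | δ ≤ ‖x - y‖} = {z | δ ≤ ‖z‖} := by
    ext z
    simp
  rw [truncFracLaplacian, ← (measurePreserving_add_left volume x).setIntegral_preimage_emb
    (Homeomorph.addLeft x).measurableEmbedding, hpre, neg_mul, ← mul_neg, ← integral_neg]
  congr 2 with z
  simp only [sub_add_cancel_left, norm_neg]
  ring

/-- The `s`-dependent constant in the bound for the fractional Laplacian of the barrier; it is
`-(-Δ)^s ⟨·⟩ ^ β` at the origin. -/
noncomputable def barrierConst (N : ℕ) (s β : ℝ) : ℝ :=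
  fracConst N s * ∫ z : Eucl N, bracketKernel ((N : ℝ) + 2 * s) β z

theorem barrierConst_nonneg (N : ℕ) (hs0 : 0 < s) (hs1 : s < 1) {β : ℝ} (hβ : 0 ≤ β) :
    0 ≤ barrierConst N s β :=
  mul_nonneg (fracConst_nonneg N hs0 hs1) (integral_nonneg (bracketKernel_nonneg _ hβ))

theorem integrable_bracketKernel_eucl (hs1 : s < 1) {β : ℝ} (hβ : 0 ≤ β) (hβs : β < 2 * s) :
    Integrable (bracketKernel (E := Eucl N) ((N : ℝ) + 2 * s) β) := by
  refine integrable_bracketKernel volume hβ ?_ ?_ <;> rw [finrank_euclideanSpace_fin] <;> linarith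

theorem integral_bracketKernel_inv_smul {r : ℝ} (hr : 0 < r) (β : ℝ) :
    ∫ z : Eucl N, r ^ (-((N : ℝ) + 2 * s)) * bracketKernel ((N : ℝ) + 2 * s) β (r⁻¹ • z) =
      r ^ (-(2 * s)) * ∫ z : Eucl N, bracketKernel ((N : ℝ) + 2 * s) β z := by
  rw [integral_const_mul, Measure.integral_comp_inv_smul_of_nonneg volume _ hr.le, smul_eq_mul,
    ← mul_assoc, finrank_euclideanSpace_fin, ← Real.rpow_natCast, ← Real.rpow_add hr]
  congr 2
  ring

theorem setIntegral_secondDiff_le (hs0 : 0 < s) (hs1 : s < 1) {β ε δ : ℝ} (hβ : 0 ≤ β)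
    (hβs : β < 2 * s) (hε : 0 ≤ ε) (hδ : 0 < δ) {u : Eucl N → ℝ} (hu : MemLs s u) {x : Eucl N}
    (hx : ∀ z, secondDiff u x z ≤ ε * secondDiff (bracketPow β) x z) :
    ∫ z in {z : Eucl N | δ ≤ ‖z‖}, secondDiff u x z / ‖z‖ ^ ((N : ℝ) + 2 * s) ≤
      2 * (ε * bracketPow (β - 2 * s) x *
        ∫ z : Eucl N, bracketKernel ((N : ℝ) + 2 * s) β z) := by
  set ν : ℝ := N + 2 * s
  set r : ℝ := bracketPow 1 x
  have hr : 0 < r := bracketPow_pos 1 x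
  have hxβ : 0 < bracketPow β x := bracketPow_pos β x
  set P : Eucl N → ℝ := fun z =>
    2 * ε * bracketPow β x * (r ^ (-ν) * bracketKernel ν β (r⁻¹ • z))
  have hP : Integrable P := (((integrable_bracketKernel_eucl hs1 hβ hβs).comp_smul
    (inv_ne_zero hr.ne')).const_mul _).const_mul _
  have hP0 (z : Eucl N) : 0 ≤ P z :=
    mul_nonneg (by positivity) (mul_nonneg (by positivity) (bracketKernel_nonneg ν hβ _))
  have hle (z : Eucl N) : secondDiff u x z / ‖z‖ ^ ν ≤ P z := by
    have hP' : P z = ε * (2 * bracketPow β x * (bracketPow β (r⁻¹ • z) - 1)) / ‖z‖ ^ ν := by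
      have hrν : r ^ (-ν) * r ^ ν = 1 := by rw [← Real.rpow_add hr, neg_add_cancel, Real.rpow_zero]
      simp only [P]
      rw [bracketKernel_inv_smul hr, ← mul_assoc (r ^ (-ν)), hrν]
      ring
    rw [hP']
    gcongr
    exact (hx z).trans (by gcongr; exact secondDiff_bracketPow_le hβ (by linarith) x z)
  calc ∫ z in {z : Eucl N | δ ≤ ‖z‖}, secondDiff u x z / ‖z‖ ^ ν
      ≤ ∫ z in {z : Eucl N | δ ≤ ‖z‖}, P z :=
        setIntegral_mono (hu.integrableOn_secondDiff_div hs0 hδ x) hP.integrableOn hle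
    _ ≤ ∫ z, P z := setIntegral_le_integral hP (ae_of_all _ hP0)
    _ = 2 * (ε * bracketPow (β - 2 * s) x * ∫ z : Eucl N, bracketKernel ν β z) := by
        simp only [P]
        rw [integral_const_mul, integral_bracketKernel_inv_smul hr, bracketPow_one_rpow,
          sub_eq_add_neg, bracketPow_add]
        ring

theorem neg_le_truncFracLaplacian (hs0 : 0 < s) (hs1 : s < 1) {β ε δ : ℝ} (hβ : 0 ≤ β)
    (hβs : β < 2 * s) (hε : 0 ≤ ε) (hδ : 0 < δ) {u : Eucl N → ℝ} (hu : MemLs s u) {x : Eucl N}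
    (hx : ∀ z, secondDiff u x z ≤ ε * secondDiff (bracketPow β) x z) :
    -(ε * barrierConst N s β * bracketPow (β - 2 * s) x) ≤ truncFracLaplacian s u x δ := by
  have hint := setIntegral_secondDiff_le hs0 hs1 hβ hβs hε hδ hu hx
  rw [hu.setIntegral_secondDiff_div hs0 hδ x] at hint
  have hmul := mul_le_mul_of_nonneg_left (le_of_mul_le_mul_left hint two_pos)
    (fracConst_nonneg N hs0 hs1)
  rw [truncFracLaplacian_eq_setIntegral, barrierConst]
  linarith

end FractionalLaplacian

section MaximumPrinciple

variable {N : ℕ} {s : ℝ}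

theorem laplacian_sub_fracLaplacian_le_of_isMaxOn (hs0 : 0 < s) (hs1 : s < 1) {α β ε : ℝ}
    (hα : 0 ≤ α) (hβ : 0 ≤ β) (hβα : β < 2 * s - α) (hε : 0 ≤ ε) {u : Eucl N → ℝ}
    (hu : ContDiff ℝ 2 u) (huL : MemLs s u) {x : Eucl N}
    (hmax : IsMaxOn (fun y => u y - ε * bracketPow β y) univ x) {l : ℝ}
    (hl : HasFracLaplacianAt s u l x) :
    Laplacian.laplacian u x - l ≤ ε * (N * β + barrierConst N s β) * bracketPow (-α) x := by
  have hdiff := secondDiff_le_of_isMaxOn hmax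
  have hlap : Laplacian.laplacian u x ≤ N * (ε * (β * bracketPow (β - 2) x)) := by
    have := laplacian_le_of_secondDiff_le hu (x := x) (b := ε * (β * bracketPow (β - 2) x))
      fun z => (hdiff z).trans <| by
        rw [mul_assoc]
        gcongr
        exact secondDiff_bracketPow_le_mul_norm_sq hβ (by linarith) x z
    rwa [finrank_euclideanSpace_fin] at this
  have hfrac : -(ε * barrierConst N s β * bracketPow (β - 2 * s) x) ≤ l :=
    ge_of_tendsto hl <| eventually_nhdsWithin_of_forall fun δ hδ =>
      neg_le_truncFracLaplacian hs0 hs1 hβ (by linarith) hε hδ huL hdiff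
  have hconst := barrierConst_nonneg N hs0 hs1 hβ
  calc Laplacian.laplacian u x - l
      ≤ N * (ε * (β * bracketPow (β - 2) x)) +
        ε * barrierConst N s β * bracketPow (β - 2 * s) x := by linarith
    _ ≤ N * (ε * (β * bracketPow (-α) x)) + ε * barrierConst N s β * bracketPow (-α) x := by
        gcongr <;> exact bracketPow_le_bracketPow (by linarith) x
    _ = ε * (N * β + barrierConst N s β) * bracketPow (-α) x := by ring

theorem nonpos_of_subsolution (hs0 : 0 < s) (hs1 : s < 1) {α κ : ℝ} (hα : 0 ≤ α) (hκ : 0 < κ)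
    {q u : Eucl N → ℝ} (hq : ∀ x, κ * bracketPow (-α) x ≤ q x) (hu : ContDiff ℝ 2 u)
    (huL : MemLs s u)
    (hsub : ∀ x, ∃ l, HasFracLaplacianAt s u l x ∧ q x * u x ≤ Laplacian.laplacian u x - l)
    {C θ : ℝ} (hθ0 : 0 ≤ θ) (hθ : θ < 2 * s - α) (hgrowth : ∀ x, u x ≤ C * bracketPow θ x)
    (x : Eucl N) : u x ≤ 0 := by
  obtain ⟨β, hθβ, hβα⟩ := exists_between hθ
  have hβ : 0 ≤ β := hθ0.trans hθβ.le
  set K : ℝ := N * β + barrierConst N s β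
  have hK : 0 ≤ K := add_nonneg (by positivity) (barrierConst_nonneg N hs0 hs1 hβ)
  have hxβ : 0 < bracketPow β x := bracketPow_pos β x
  have hbound : ∀ ε > 0, u x ≤ ε * (bracketPow β x + K / κ) := by
    intro ε hε
    obtain ⟨x₀, hx₀⟩ : ∃ x₀, ∀ y, u y - ε * bracketPow β y ≤ u x₀ - ε * bracketPow β x₀ := by
      refine (hu.continuous.sub ((continuous_bracketPow β).const_mul ε)).exists_forall_ge ?_
      refine tendsto_atBot_mono (fun y => ?_) <| tendsto_neg_atTop_atBot.comp <|
        tendsto_const_mul_bracketPow_sub_cocompact hθ0 hθβ hε C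
      simp only [Function.comp_apply, Pi.sub_apply]
      linarith [hgrowth y]
    have hpeak : u x₀ ≤ ε * (K / κ) := by
      obtain ⟨l, hl, hle⟩ := hsub x₀
      rcases le_total (u x₀) 0 with hneg | hpos
      · exact hneg.trans (by positivity)
      have hx₀α : 0 < bracketPow (-α) x₀ := bracketPow_pos _ _
      have hchain : κ * bracketPow (-α) x₀ * u x₀ ≤ ε * K * bracketPow (-α) x₀ :=
        (mul_le_mul_of_nonneg_right (hq x₀) hpos).trans <| hle.trans <|
          laplacian_sub_fracLaplacian_le_of_isMaxOn hs0 hs1 hα hβ hβα hε.le hu huL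
            (isMaxOn_univ_iff.2 hx₀) hl
      rw [← mul_div_assoc, le_div_iff₀ hκ]
      exact le_of_mul_le_mul_right (by linarith) hx₀α
    have hx₀β := mul_pos hε (bracketPow_pos β x₀)
    linarith [hx₀ x]
  refine le_of_forall_pos_le_add fun η hη => ?_
  have hD : 0 < bracketPow β x + K / κ := by positivity
  simpa [div_mul_cancel₀ η hD.ne'] using hbound _ (div_pos hη hD)

theorem IsClassicalSolution.neg {ρ c u : Eucl N → ℝ} (h : IsClassicalSolution s ρ c u) :
    IsClassicalSolution s ρ c (-u) where
  contDiff := h.contDiff.neg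
  memLs := (Integrable.neg h.memLs).congr (ae_of_all _ fun x => by simp [neg_div])
  equation x := by
    obtain ⟨l, hl, heq⟩ := h.equation x
    refine ⟨-l, (Tendsto.neg hl).congr fun ε => ?_, ?_⟩
    · rw [truncFracLaplacian, truncFracLaplacian, ← mul_neg, ← integral_neg]
      congr 2 with y
      simp only [Pi.neg_apply]
      ring
    · rw [InnerProductSpace.laplacian_neg]
      simp only [Pi.neg_apply]
      linarith

theorem IsClassicalSolution.nonpos (hs0 : 0 < s) (hs1 : s < 1) {α κ : ℝ} (hα : 0 ≤ α)
    (hκ : 0 < κ) {ρ c u : Eucl N → ℝ} (hρc : ∀ x, κ * bracketPow (-α) x ≤ ρ x * c x)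
    (hu : IsClassicalSolution s ρ c u) {C θ : ℝ} (hθ0 : 0 ≤ θ) (hθ : θ < 2 * s - α)
    (hgrowth : ∀ x, u x ≤ C * bracketPow θ x) (x : Eucl N) : u x ≤ 0 := by
  refine nonpos_of_subsolution hs0 hs1 hα hκ hρc hu.contDiff hu.memLs (fun y => ?_) hθ0 hθ
    hgrowth x
  obtain ⟨l, hl, heq⟩ := hu.equation y
  exact ⟨l, hl, by linarith⟩

end MaximumPrinciple

end MixedElliptic

theorem corollary2p8_general {N : ℕ} {s : ℝ} (hs0 : 0 < s) (hs1 : s < 1) {α κ : ℝ} (hα : 0 ≤ α)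
    (hκ : 0 < κ) {ρ c u : MixedElliptic.Eucl N → ℝ}
    (hρc : ∀ x, κ * (1 + ‖x‖ ^ 2) ^ (-α / 2) ≤ ρ x * c x)
    (hu : MixedElliptic.IsClassicalSolution s ρ c u) {C θ : ℝ} (hθ0 : 0 ≤ θ)
    (hθ : θ < 2 * s - α) (hgrowth : ∀ x, |u x| ≤ C * (1 + ‖x‖ ^ 2) ^ (θ / 2))
    (x : MixedElliptic.Eucl N) : u x = 0 := by
  refine le_antisymm ?_ (neg_nonpos.1 ?_)
  · exact hu.nonpos hs0 hs1 hα hκ hρc hθ0 hθ (fun y => (le_abs_self _).trans (hgrowth y)) x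
  · exact hu.neg.nonpos hs0 hs1 hα hκ hρc hθ0 hθ (fun y => (neg_le_abs _).trans (hgrowth y)) x

theorem corollary2p8 (N : ℕ) (hN : 1 ≤ N) (s : ℝ) (hs0 : 0 < s) (hs1 : s < 1)
    (α C₀ : ℝ) (hα : 0 ≤ α) (hαs : α < 2 * s) (hC₀ : 0 < C₀) :
    ∃ K : ℝ, ∀ p c₀ : ℝ, 1 ≤ p → 0 < c₀ → K ≤ p * c₀ →
      ∀ ρ c : MixedElliptic.Eucl N → ℝ,
        MixedElliptic.HypRho α C₀ ρ → MixedElliptic.HypC c → (∀ x, c₀ ≤ c x) →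
        ∀ u : MixedElliptic.Eucl N → ℝ, MixedElliptic.IsClassicalSolution s ρ c u →
          ∀ C θ : ℝ, 0 < C → 0 ≤ θ → θ < 2 * s - α →
            (∀ x, |u x| ≤ C * (1 + ‖x‖ ^ 2) ^ (θ / 2)) →
            ∀ x, u x = 0 := by
  refine ⟨0, fun p c₀ _ hc₀ _ ρ c hρ _ hc u hu C θ _ hθ0 hθ hgrowth =>
    corollary2p8_general hs0 hs1 hα (mul_pos hC₀ hc₀) (fun y => ?_) hu hθ0 hθ hgrowth⟩
  rw [mul_right_comm]
  have hy := hρ.lower_bound y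
  exact mul_le_mul hy (hc y) hc₀.le (le_trans (by positivity) hy)
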